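/- Let $d\ge 2$ and let $\mathbb X\subset\mathbb R^d$ be a compact region, i.e. a compact set which is the closure of a nonempty connected open set. Let $\boldsymbol X$ be a random vector in $\mathbb R^d$ whose distribution has a density $p\ge 0$ with $\operatorname{supp} p=\mathbb X$ that is smooth and strictly positive in the interior of $\mathbb X$ (for instance a uniform density), and suppose that $p$ is reflectionally symmetric: $p(x_1,\dots,x_{d-1},x_d)=p(x_1,\dots,x_{d-1},-x_d)$ for all $x$. Put $\mathcal H_d=\{x\in\mathbb R^d: x_d=0\}$. Let $\Gamma:[0,\ell]\to\mathbb X$, $\ell>0$, be an injective $C^\infty$ curve parameterized by arc length, with tangent $T=\Gamma'$. Let $\lambda_\Gamma(x)=\sup\{s\in[0,\ell]:\|x-\Gamma(s)\|=\inf_{t\in[0,\ell]}\|x-\Gamma(t)\|\}$ be its projection index and $\pi_\Gamma=\Gamma\circ\lambda_\Gamma$. Assume that $\Gamma$ is a principal curve of $\boldsymbol X$, i.e. $\mathbb E[\boldsymbol X\mid\lambda_\Gamma(\boldsymbol X)]=\Gamma(\lambda_\Gamma(\boldsymbol X))$ almost surely, and that it is admissible: for some vector fields $N_1,\dots,N_{d-1}\in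 C^\infty([0,\ell];\mathbb R^d)$ such that $T(s),N_1(s),\dots,N_{d-1}(s)$ is an orthonormal basis for every $s$, and with $\nu_\Gamma(s,u)=\Gamma(s)+\sum_{i}u_iN_i(s)$ and $\mu_\Gamma(x)=\bigl(\lambda_\Gamma(x),(\langle x-\pi_\Gamma(x),N_i(\lambda_\Gamma(x))\rangle)_{i}\bigr)$, (i) no point of $\mathbb X$ has more than one closest point on $\Gamma$, and $\nu_\Gamma(\mu_\Gamma(x))=x$ for all $x\in\mathbb X$; (ii) the restriction of $\nu_\Gamma$ to $\{(s,u)\in[0,\ell]\times\mathbb R^{d-1}:\nu_\Gamma(s,u)\in\mathbb X\}$ is a diffeomorphism onto its image (in particular, the normal hyperplanes of $\Gamma$ at different times do not meet inside $\mathbb X$). Assume finally that $\Gamma$ does not change sides of $\mathcal H_d$ infinitely often as $s\downarrow 0$: there is $\delta>0$ such that the $d$-th coordinate of $\Gamma(s)$ is $\ge 0$ for all $s\in[0,\ell]$ with $s\le\delta$, or is $\le 0$ for all such $s$. If $\Gamma(0)\in\partial\mathbb X\cap\mathcal H_d$, then $\Gamma(s)\in\mathcal H_d$ for all $s\in[0,\ell]$.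 -/

import Mathlib

open MeasureTheory Set
open scoped ContDiff

noncomputable section

namespace PrincipalCurve

/-- The space `ℝ^(n+1)` with its Euclidean norm. -/
abbrev Space (n : ℕ) : Type := EuclideanSpace ℝ (Fin (n + 1))

/-- A compact region: a compact set that is the closure of a (nonempty) connected open set. -/
structure IsCompactRegion {n : ℕ} (K : Set (Space n)) : Prop where
  isCompact : IsCompact K
  isConnected_interior : IsConnected (interior K)
  closure_interior : closure (interior K) = K

/-- `p` is a density of the random vector `X`, with support `K`, smooth and strictly positive in
the interior of `K`. -/
structure IsSmoothDensity {Ω : Type*} [MeasurableSpace Ω] (P : Measure Ω) {n : ℕ}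
    (X : Ω → Space n) (K : Set (Space n)) (p : Space n → ℝ) : Prop where
  measurable : Measurable p
  nonneg : ∀ x, 0 ≤ p x
  law : P.map X = (volume : Measure (Space n)).withDensity (fun x => ENNReal.ofReal (p x))
  support : tsupport p = K
  smooth : ContDiffOn ℝ ∞ p (interior K)
  pos : ∀ x ∈ interior K, 0 < p x

/-- The reflection `(x₁, …, x_{d-1}, x_d) ↦ (x₁, …, x_{d-1}, -x_d)`. -/
def reflect {n : ℕ} (x : Space n) : Space n :=
  WithLp.toLp 2 (fun i => if i = Fin.last n then - x i else x i)

/-- The hyperplane `x_d = 0`. -/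
def symHyperplane (n : ℕ) : Set (Space n) := {x | x (Fin.last n) = 0}

/-- Reflectional symmetry of a density. -/
def IsReflectionallySymmetric {n : ℕ} (p : Space n → ℝ) : Prop :=
  ∀ x, p (reflect x) = p x

/-- A smooth non-self-intersecting curve `Γ : [0, ℓ] → ℝ^(n+1)` parameterized by arc length. Only
the values of `Γ` on `[0, ℓ]` matter. -/
structure IsSmoothJordanCurve {n : ℕ} (ℓ : ℝ) (Γ : ℝ → Space n) : Prop where
  length_pos : 0 < ℓ
  smooth : ContDiffOn ℝ ∞ Γ (Icc 0 ℓ)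
  unit_speed : ∀ s ∈ Icc 0 ℓ, ‖derivWithin Γ (Icc 0 ℓ) s‖ = 1
  injOn : InjOn Γ (Icc 0 ℓ)

/-- `Γ s` is a closest point to `x` on the curve. -/
def IsClosestAt {n : ℕ} (ℓ : ℝ) (Γ : ℝ → Space n) (x : Space n) (s : ℝ) : Prop :=
  s ∈ Icc 0 ℓ ∧ ‖x - Γ s‖ = sInf ((fun t => ‖x - Γ t‖) '' Icc 0 ℓ)

/-- The points with several closest points on the curve. -/
def ambiguitySet {n : ℕ} (ℓ : ℝ) (Γ : ℝ → Space n) : Set (Space n) :=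
  {x | ∃ s t, IsClosestAt ℓ Γ x s ∧ IsClosestAt ℓ Γ x t ∧ Γ s ≠ Γ t}

/-- The projection index `λ_Γ`. -/
def projIndex {n : ℕ} (ℓ : ℝ) (Γ : ℝ → Space n) (x : Space n) : ℝ :=
  sSup {s | IsClosestAt ℓ Γ x s}

/-- The projection `π_Γ = Γ ∘ λ_Γ`. -/
def proj {n : ℕ} (ℓ : ℝ) (Γ : ℝ → Space n) (x : Space n) : Space n :=
  Γ (projIndex ℓ Γ x)

/-- Self-consistency: `E[X | λ_Γ(X)] = Γ(λ_Γ(X))` almost surely. -/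
def IsSelfConsistent {Ω : Type*} [MeasurableSpace Ω] (P : Measure Ω) {n : ℕ}
    (X : Ω → Space n) (ℓ : ℝ) (Γ : ℝ → Space n) : Prop :=
  condExp (MeasurableSpace.comap (fun a => projIndex ℓ Γ (X a)) inferInstance) P X
    =ᵐ[P] fun a => Γ (projIndex ℓ Γ (X a))

/-- A principal curve of `X`: a smooth self-consistent Jordan curve. -/
structure IsPrincipalCurve {Ω : Type*} [MeasurableSpace Ω] (P : Measure Ω) {n : ℕ}
    (X : Ω → Space n) (ℓ : ℝ) (Γ : ℝ → Space n) : Prop where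
  jordan : IsSmoothJordanCurve ℓ Γ
  selfConsistent : IsSelfConsistent P X ℓ Γ

/-- Vectors `N₁(s), …, N_{d-1}(s)`, smooth in `s ∈ [0, ℓ]`, that together with the tangent
`T(s) = Γ'(s)` form an orthonormal frame. -/
structure IsMovingFrame {n : ℕ} (ℓ : ℝ) (Γ : ℝ → Space n) (N : Fin n → ℝ → Space n) : Prop where
  smooth : ∀ i, ContDiffOn ℝ ∞ (N i) (Icc 0 ℓ)
  orthonormal : ∀ s ∈ Icc 0 ℓ, Orthonormal ℝ (fun i => N i s)
  orthogonal_tangent : ∀ s ∈ Icc 0 ℓ, ∀ i, inner ℝ (derivWithin Γ (Icc 0 ℓ) s) (N i s) = 0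

/-- The normal coordinate map `ν_Γ(s, u) = Γ(s) + ∑ᵢ uᵢ Nᵢ(s)`. -/
def normalMap {n : ℕ} (Γ : ℝ → Space n) (N : Fin n → ℝ → Space n)
    (q : ℝ × EuclideanSpace ℝ (Fin n)) : Space n :=
  Γ q.1 + ∑ i, q.2 i • N i q.1

/-- The normal coordinate transformation
`μ_Γ(x) = (λ_Γ(x), (⟨x - π_Γ(x), Nᵢ(λ_Γ(x))⟩)ᵢ)`. -/
def normalTransform {n : ℕ} (ℓ : ℝ) (Γ : ℝ → Space n) (N : Fin n → ℝ → Space n)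
    (x : Space n) : ℝ × EuclideanSpace ℝ (Fin n) :=
  (projIndex ℓ Γ x,
    WithLp.toLp 2 (fun i => inner ℝ (x - proj ℓ Γ x) (N i (projIndex ℓ Γ x))))

/-- `f` restricted to `D` is a diffeomorphism onto its image: it is smooth on `D` and has an
inverse that is smooth on the image `f(D)`. -/
def IsDiffeoOntoImage {E F : Type*} [NormedAddCommGroup E] [NormedSpace ℝ E]
    [NormedAddCommGroup F] [NormedSpace ℝ F] (f : E → F) (D : Set E) : Prop :=
  ContDiffOn ℝ ∞ f D ∧ ∃ g : F → E, LeftInvOn g f D ∧ ContDiffOn ℝ ∞ g (f '' D)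

/-- The part of `[0, ℓ] × ℝ^(d-1)` that the normal coordinate map sends into `K`: the disjoint
union over `s` of the cross-sections of `K` with the normal hyperplanes, in normal coordinates. -/
def normalDomain {n : ℕ} (K : Set (Space n)) (ℓ : ℝ) (Γ : ℝ → Space n)
    (N : Fin n → ℝ → Space n) : Set (ℝ × EuclideanSpace ℝ (Fin n)) :=
  {q | q.1 ∈ Icc 0 ℓ ∧ normalMap Γ N q ∈ K}

/-- Admissibility of a curve in `K`: there are no ambiguity points in `K`, so that `μ_Γ` inverts
the normal coordinates, `ν_Γ ∘ μ_Γ = id` on `K`; and `ν_Γ` is a diffeomorphism, over `K`, onto its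
image. In particular the normal hyperplanes at different times do not meet inside `K`. -/
def IsAdmissible {n : ℕ} (K : Set (Space n)) (ℓ : ℝ) (Γ : ℝ → Space n) : Prop :=
  ∃ N : Fin n → ℝ → Space n, IsMovingFrame ℓ Γ N ∧
    (∀ x ∈ K, x ∉ ambiguitySet ℓ Γ) ∧
    (∀ x ∈ K, normalMap Γ N (normalTransform ℓ Γ N x) = x) ∧
    IsDiffeoOntoImage (normalMap Γ N) (normalDomain K ℓ Γ N)

/-- The curve does not change sides of the hyperplane `x_d = 0` infinitely often as `s ↓ 0`: it
stays in one of the two closed half-spaces for a short time. -/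
def StartsOnOneSide {n : ℕ} (ℓ : ℝ) (Γ : ℝ → Space n) : Prop :=
  ∃ δ > 0, (∀ s ∈ Icc 0 ℓ, s ≤ δ → 0 ≤ Γ s (Fin.last n)) ∨
    (∀ s ∈ Icc 0 ℓ, s ≤ δ → Γ s (Fin.last n) ≤ 0)

end PrincipalCurve

end

namespace PrincipalCurve

variable {n : ℕ} {ℓ : ℝ} {Γ : ℝ → Space n} {K : Set (Space n)}

/-! Write `λ` for the projection index, `T` for the tangent, `τ(s)` for its last coordinate and `μ`
for the law of `X`. On `K`, admissibility makes the hyperplane normal to `Γ` at `s` exactly the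
fibre `λ = s`, so `{λ ≤ s}` is, up to a null set, the half-space `{height s ≤ 0}`
(`height_nonpos_iff`). Integrating self-consistency over it shows that the first moment of `x_d`
over this half-space equals `I(s) = ∫_{λ ≤ s} Γ_d(λ) dμ` (`setIntegral_last_eq`).

Since `μ` is mirror symmetric, mirror pairs contained in the half-space cancel in that moment, and
what remains has sign opposite to `τ(s)`. Hence `τ(s) I(s) ≤ 0`, with a quantitative gain from the
asymmetric part (`two_mul_tilt_mul_setIntegral_le`): a curve whose past lies on average on one side
of the mirror cannot be moving further to that side.

Two consequences finish the proof. A curve that starts on the mirror and stays weakly on one side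
for a short time cannot leave it in that time, since it would have to move away at some moment when
`I` already has the sign of the motion. Once the curve has stayed on the mirror up to `s₀ < ℓ`, the
gain gives `c |τ(s)| ≤ |I(s)|` near `s₀`, while `|I(s)|` is at most `(s - s₀) sup |τ|`; a
Grönwall-type absorption forces `τ = 0` just after `s₀`. A supremum argument then covers `[0, ℓ]`.
-/

/-- The signed height of `x` over the hyperplane through `Γ s` that is normal to the curve. -/
noncomputable def height (ℓ : ℝ) (Γ : ℝ → Space n) (s : ℝ) (x : Space n) : ℝ :=
  inner ℝ (x - Γ s) (derivWithin Γ (Icc 0 ℓ) s)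

/-! ### Closest points and measurability of the projection index -/

theorem exists_isClosestAt (hℓ : 0 < ℓ) (hc : ContinuousOn Γ (Icc 0 ℓ)) (x : Space n) :
    ∃ s, IsClosestAt ℓ Γ x s := by
  have hcont : ContinuousOn (fun t => ‖x - Γ t‖) (Icc 0 ℓ) := (continuousOn_const.sub hc).norm
  obtain ⟨s, hs, h⟩ := isCompact_Icc.exists_sInf_image_eq (nonempty_Icc.2 hℓ.le) hcont
  exact ⟨s, hs, h.symm⟩

theorem IsClosestAt.le {x : Space n} {s t : ℝ} (h : IsClosestAt ℓ Γ x s) (ht : t ∈ Icc 0 ℓ) :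
    ‖x - Γ s‖ ≤ ‖x - Γ t‖ := by
  rw [h.2]
  exact csInf_le ⟨0, by rintro _ ⟨u, -, rfl⟩; exact norm_nonneg _⟩ ⟨t, ht, rfl⟩

theorem isClosestAt_of_forall_le {x : Space n} {s : ℝ} (hs : s ∈ Icc 0 ℓ)
    (h : ∀ t ∈ Icc 0 ℓ, ‖x - Γ s‖ ≤ ‖x - Γ t‖) : IsClosestAt ℓ Γ x s := by
  refine ⟨hs, le_antisymm ?_ ?_⟩
  · exact le_csInf ⟨_, s, hs, rfl⟩ (by rintro _ ⟨u, hu, rfl⟩; exact h u hu)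
  · exact csInf_le ⟨0, by rintro _ ⟨u, -, rfl⟩; exact norm_nonneg _⟩ ⟨s, hs, rfl⟩

/-- These are the superlevel sets of the projection index, which is thus Borel. Such an `x` is at
least as near to the compact arc `Γ '' [c, ℓ]` as to every point of the curve, a closed condition on
`x`. -/
theorem isClosed_setOf_isClosestAt (hc : ContinuousOn Γ (Icc 0 ℓ)) (c : ℝ) :
    IsClosed {x | ∃ s, c ≤ s ∧ IsClosestAt ℓ Γ x s} := by
  -- The empty arc must be treated apart: `Metric.infDist` to the empty set is `0`, so the formula
  -- below would give the whole space.
  rcases le_or_gt (max 0 c) ℓ with h0 | h0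
  swap
  · convert isClosed_empty
    refine eq_empty_of_forall_notMem ?_
    rintro x ⟨s, hcs, hs, -⟩
    exact (h0.trans_le (max_le hs.1 hcs |>.trans hs.2)).false
  have hsub : Icc (max 0 c) ℓ ⊆ Icc 0 ℓ := Icc_subset_Icc_left (le_max_left _ _)
  have hne : (Γ '' Icc (max 0 c) ℓ).Nonempty := (nonempty_Icc.2 h0).image _
  have hcpt : IsCompact (Γ '' Icc (max 0 c) ℓ) := isCompact_Icc.image_of_continuousOn (hc.mono hsub)
  have : {x | ∃ s, c ≤ s ∧ IsClosestAt ℓ Γ x s} =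
      ⋂ t ∈ Icc 0 ℓ, {x | Metric.infDist x (Γ '' Icc (max 0 c) ℓ) ≤ ‖x - Γ t‖} := by
    ext x
    rw [mem_iInter₂]
    constructor
    · rintro ⟨s, hcs, hs⟩ t ht
      refine (Metric.infDist_le_dist_of_mem (mem_image_of_mem Γ
        (show s ∈ Icc (max 0 c) ℓ from ⟨max_le hs.1.1 hcs, hs.1.2⟩))).trans ?_
      rw [dist_eq_norm]
      exact hs.le ht
    · intro h
      obtain ⟨_, ⟨s, hs, rfl⟩, hxs⟩ := hcpt.exists_infDist_eq_dist hne x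
      refine ⟨s, (le_max_right _ _).trans hs.1, isClosestAt_of_forall_le (hsub hs) fun t ht => ?_⟩
      rw [← dist_eq_norm, ← hxs]
      exact h t ht
  rw [this]
  refine isClosed_biInter fun t _ => isClosed_le (Metric.continuous_infDist_pt _) ?_
  fun_prop

theorem bddAbove_isClosestAt (x : Space n) : BddAbove {s | IsClosestAt ℓ Γ x s} :=
  ⟨ℓ, fun _ hs => hs.1.2⟩

theorem isClosed_isClosestAt (hc : ContinuousOn Γ (Icc 0 ℓ)) (x : Space n) :
    IsClosed {s | IsClosestAt ℓ Γ x s} := by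
  have hcont : ContinuousOn (fun t => ‖x - Γ t‖) (Icc 0 ℓ) := (continuousOn_const.sub hc).norm
  exact hcont.preimage_isClosed_of_isClosed isClosed_Icc isClosed_singleton

theorem isClosestAt_projIndex (hℓ : 0 < ℓ) (hc : ContinuousOn Γ (Icc 0 ℓ)) (x : Space n) :
    IsClosestAt ℓ Γ x (projIndex ℓ Γ x) :=
  (isClosed_isClosestAt hc x).csSup_mem (exists_isClosestAt hℓ hc x) (bddAbove_isClosestAt x)

theorem measurable_projIndex (hℓ : 0 < ℓ) (hc : ContinuousOn Γ (Icc 0 ℓ)) :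
    Measurable (projIndex ℓ Γ) := by
  refine measurable_of_Ici fun c => ?_
  convert (isClosed_setOf_isClosestAt hc c).measurableSet using 1
  ext x
  exact ⟨fun h => ⟨_, h, isClosestAt_projIndex hℓ hc x⟩,
    fun ⟨s, hcs, hs⟩ => hcs.trans (le_csSup (bddAbove_isClosestAt x) hs)⟩

/-! ### Normal hyperplanes as fibres of the projection index -/

theorem IsSmoothJordanCurve.continuousOn (h : IsSmoothJordanCurve ℓ Γ) :
    ContinuousOn Γ (Icc 0 ℓ) := h.smooth.continuousOn

theorem IsSmoothJordanCurve.continuousOn_derivWithin (h : IsSmoothJordanCurve ℓ Γ) :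
    ContinuousOn (derivWithin Γ (Icc 0 ℓ)) (Icc 0 ℓ) :=
  h.smooth.continuousOn_derivWithin (uniqueDiffOn_Icc h.length_pos) (by simp)

theorem IsSmoothJordanCurve.hasDerivWithinAt (h : IsSmoothJordanCurve ℓ Γ) {s : ℝ}
    (hs : s ∈ Icc 0 ℓ) : HasDerivWithinAt Γ (derivWithin Γ (Icc 0 ℓ) s) (Icc 0 ℓ) s :=
  ((h.smooth.differentiableOn (by simp)) s hs).hasDerivWithinAt

/-- A vector that is orthogonal to the tangent is a combination of the normal fields. -/
theorem IsMovingFrame.sum_inner_smul {N : Fin n → ℝ → Space n} (hΓ : IsSmoothJordanCurve ℓ Γ)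
    (hN : IsMovingFrame ℓ Γ N) {s : ℝ} (hs : s ∈ Icc 0 ℓ) {v : Space n}
    (hv : inner ℝ v (derivWithin Γ (Icc 0 ℓ) s) = 0) :
    ∑ i, inner ℝ v (N i s) • N i s = v := by
  set T := derivWithin Γ (Icc 0 ℓ) s with hT
  have hTN : ∀ i, inner ℝ T (N i s) = 0 := hN.orthogonal_tangent s hs
  have hNN := hN.orthonormal s hs
  let b : Fin (n + 1) → Space n := Fin.cons T (fun i => N i s)
  have hb : Orthonormal ℝ b := by
    refine ⟨fun i => ?_, fun i j hij => ?_⟩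
    · refine Fin.cases ?_ (fun i => ?_) i
      · exact hΓ.unit_speed s hs
      · exact hNN.1 i
    · induction i using Fin.cases with
      | zero =>
        induction j using Fin.cases with
        | zero => exact absurd rfl hij
        | succ j => exact hTN j
      | succ i =>
        induction j using Fin.cases with
        | zero => exact (real_inner_comm _ _).trans (hTN i)
        | succ j => exact hNN.2 (fun h => hij (congrArg Fin.succ h))
  have hspan : ⊤ ≤ Submodule.span ℝ (range b) := by
    rw [hb.linearIndependent.span_eq_top_of_card_eq_finrank (by simp)]
  have := (OrthonormalBasis.mk hb hspan).sum_repr' v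
  simp only [OrthonormalBasis.coe_mk, Fin.sum_univ_succ] at this
  simp only [b, Fin.cons_zero, Fin.cons_succ, real_inner_comm v, hv, zero_smul, zero_add] at this
  exact this

/-- A point of `K` on the normal hyperplane at `s` has normal coordinates with first entry `s`, and
injectivity of `ν_Γ` over `K` identifies them with `μ_Γ(x)`. The converse uses `ν_Γ ∘ μ_Γ = id`,
which gives orthogonality even when the closest point is an endpoint of the curve. -/
theorem height_eq_zero_iff (hΓ : IsSmoothJordanCurve ℓ Γ) (hadm : IsAdmissible K ℓ Γ)
    {x : Space n} (hx : x ∈ K) {s : ℝ} (hs : s ∈ Icc 0 ℓ) :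
    height ℓ Γ s x = 0 ↔ s = projIndex ℓ Γ x := by
  obtain ⟨N, hN, -, hνμ, -, g, hg, -⟩ := hadm
  have hcl := isClosestAt_projIndex hΓ.length_pos hΓ.continuousOn x
  constructor
  · intro h
    have hν : normalMap Γ N (s, WithLp.toLp 2 (fun i => inner ℝ (x - Γ s) (N i s))) = x := by
      simp only [normalMap]
      rw [hN.sum_inner_smul hΓ hs h, add_sub_cancel]
    have h1 := hg (show (s, _) ∈ normalDomain K ℓ Γ N from ⟨hs, by rw [hν]; exact hx⟩)
    have h2 := hg (show normalTransform ℓ Γ N x ∈ normalDomain K ℓ Γ N from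
      ⟨hcl.1, by rw [hνμ x hx]; exact hx⟩)
    rw [hν] at h1
    rw [hνμ x hx, h1] at h2
    exact congrArg Prod.fst h2
  · rintro rfl
    have h := hνμ x hx
    rw [normalMap, ← eq_sub_iff_add_eq'] at h
    change inner ℝ (x - Γ (projIndex ℓ Γ x)) _ = 0
    change _ = x - Γ (projIndex ℓ Γ x) at h
    rw [← h, sum_inner]
    refine Finset.sum_eq_zero fun i _ => ?_
    rw [real_inner_smul_left, real_inner_comm]
    change _ * inner ℝ _ (N i (projIndex ℓ Γ x)) = 0
    rw [hN.orthogonal_tangent _ hcl.1, mul_zero]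

theorem continuousOn_height (hΓ : IsSmoothJordanCurve ℓ Γ) (x : Space n) :
    ContinuousOn (fun s => height ℓ Γ s x) (Icc 0 ℓ) :=
  (continuousOn_const.sub hΓ.continuousOn).inner hΓ.continuousOn_derivWithin

/-- Mean value theorem: `‖x - Γ s‖ ^ 2` has derivative `-2 * height ℓ Γ s x`. -/
theorem exists_slope_eq_height (hΓ : IsSmoothJordanCurve ℓ Γ) (x : Space n) {a b : ℝ}
    (ha : 0 ≤ a) (hab : a < b) (hb : b ≤ ℓ) :
    ∃ t ∈ Ioo a b, ‖x - Γ b‖ ^ 2 - ‖x - Γ a‖ ^ 2 = -2 * height ℓ Γ t x * (b - a) := by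
  have hsub : Icc a b ⊆ Icc 0 ℓ := Icc_subset_Icc ha hb
  obtain ⟨t, ht, h⟩ := exists_hasDerivAt_eq_slope (fun s => ‖x - Γ s‖ ^ 2)
    (fun s => -2 * height ℓ Γ s x) hab
    (((continuousOn_const.sub (hΓ.continuousOn.mono hsub)).norm).pow 2) (fun s hs => by
      have hs' : s ∈ Ioo 0 ℓ := ⟨ha.trans_lt hs.1, hs.2.trans_le hb⟩
      have h1 := (hΓ.hasDerivWithinAt (Ioo_subset_Icc_self hs')).hasDerivAt
        (Icc_mem_nhds hs'.1 hs'.2)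
      convert (h1.const_sub x).norm_sq using 1
      simp [height, inner_neg_right])
  refine ⟨t, ht, ?_⟩
  rw [h, div_mul_cancel₀ _ (sub_pos.2 hab).ne']

/-- The squared distance at `s` is no smaller than at the closest point, so the height is
nonpositive somewhere in between. It has no zero after `projIndex ℓ Γ x`, hence by continuity no
change of sign. -/
theorem height_neg (hΓ : IsSmoothJordanCurve ℓ Γ) (hadm : IsAdmissible K ℓ Γ)
    {x : Space n} (hx : x ∈ K) {s : ℝ} (hs : s ∈ Icc 0 ℓ) (h : projIndex ℓ Γ x < s) :
    height ℓ Γ s x < 0 := by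
  have hcl := isClosestAt_projIndex hΓ.length_pos hΓ.continuousOn x
  obtain ⟨t, ht, hs1⟩ := exists_slope_eq_height hΓ x hcl.1.1 h hs.2
  have ht' : t ∈ Icc 0 ℓ := ⟨hcl.1.1.trans ht.1.le, ht.2.le.trans hs.2⟩
  have h2 : height ℓ Γ t x ≤ 0 := by
    have h3 := pow_le_pow_left₀ (norm_nonneg _) (hcl.le hs) 2
    have h4 := sub_pos.2 h
    by_contra! h5
    nlinarith [mul_pos h5 h4]
  by_contra! h5
  obtain ⟨u, hu, hu0⟩ := intermediate_value_Icc ht.2.le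
    ((continuousOn_height hΓ x).mono (Icc_subset_Icc ht'.1 hs.2)) ⟨h2, h5⟩
  have := (height_eq_zero_iff hΓ hadm hx ⟨ht'.1.trans hu.1, hu.2.trans hs.2⟩).1 hu0
  linarith [hu.1, ht.1]

theorem height_pos (hΓ : IsSmoothJordanCurve ℓ Γ) (hadm : IsAdmissible K ℓ Γ)
    {x : Space n} (hx : x ∈ K) {s : ℝ} (hs : s ∈ Icc 0 ℓ) (h : s < projIndex ℓ Γ x) :
    0 < height ℓ Γ s x := by
  have hcl := isClosestAt_projIndex hΓ.length_pos hΓ.continuousOn x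
  obtain ⟨t, ht, hs1⟩ := exists_slope_eq_height hΓ x hs.1 h hcl.1.2
  have ht' : t ∈ Icc 0 ℓ := ⟨hs.1.trans ht.1.le, ht.2.le.trans hcl.1.2⟩
  have h2 : 0 ≤ height ℓ Γ t x := by
    have h3 := pow_le_pow_left₀ (norm_nonneg _) (hcl.le hs) 2
    have h4 := sub_pos.2 h
    by_contra! h5
    nlinarith [mul_pos_of_neg_of_neg h5 (neg_neg_of_pos h4)]
  by_contra! h5
  obtain ⟨u, hu, hu0⟩ := intermediate_value_Icc ht.1.le
    ((continuousOn_height hΓ x).mono (Icc_subset_Icc hs.1 ht'.2)) ⟨h5, h2⟩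
  have := (height_eq_zero_iff hΓ hadm hx ⟨hs.1.trans hu.1, hu.2.trans ht'.2⟩).1 hu0
  linarith [hu.2, ht.2]

theorem height_nonpos_iff (hΓ : IsSmoothJordanCurve ℓ Γ) (hadm : IsAdmissible K ℓ Γ)
    {x : Space n} (hx : x ∈ K) {s : ℝ} (hs : s ∈ Icc 0 ℓ) :
    height ℓ Γ s x ≤ 0 ↔ projIndex ℓ Γ x ≤ s := by
  constructor
  · intro h
    by_contra! h1
    exact (height_pos hΓ hadm hx hs h1).not_ge h
  · intro h
    rcases h.lt_or_eq with h | h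
    · exact (height_neg hΓ hadm hx hs h).le
    · exact ((height_eq_zero_iff hΓ hadm hx hs).2 h.symm).le

theorem projIndex_apply_curve (hΓ : IsSmoothJordanCurve ℓ Γ) {t : ℝ} (ht : t ∈ Icc 0 ℓ) :
    projIndex ℓ Γ (Γ t) = t := by
  have hcl := isClosestAt_projIndex hΓ.length_pos hΓ.continuousOn (Γ t)
  refine (hΓ.injOn ht hcl.1 ?_).symm
  have := hcl.le ht
  rw [sub_self, norm_zero] at this
  exact sub_eq_zero.1 (norm_le_zero_iff.1 this)

/-! ### Volume of thin slabs -/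

/-- The volume of a thin slab inside a ball is at least proportional to the width of the slab. -/
theorem exists_mul_le_volume_slab (z : Space n) {r : ℝ} (hr : 0 < r) :
    ∃ c > 0, ∀ (w : Space n) (b ε : ℝ), 1 / 2 ≤ ‖w‖ ^ 2 → ‖w‖ ≤ 1 →
      |inner ℝ z w - b| ≤ r / 8 → 0 < ε → ε ≤ r / 16 →
      c * ε ≤ volume.real (Metric.ball z r ∩ {x | |inner ℝ x w - b| ≤ ε}) := by
  have hv : 0 < volume.real (Metric.ball z (r / 8)) :=
    ENNReal.toReal_pos (Metric.measure_ball_pos _ _ (by positivity)).ne' measure_ball_lt_top.ne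
  refine ⟨volume.real (Metric.ball z (r / 8)) / r, by positivity, ?_⟩
  intro w b ε hw hw1 hz hε hεr
  set S : Set (Space n) := Metric.ball z r ∩ {x | |inner ℝ x w - b| ≤ ε} with hS
  have hSfin : volume S ≠ ⊤ := ((measure_mono inter_subset_left).trans_lt measure_ball_lt_top).ne
  -- Translation along `v` changes `inner ℝ x w` at unit rate.
  set v : Space n := (‖w‖ ^ 2)⁻¹ • w with hvdef
  have hvw : inner ℝ v w = 1 := by
    rw [hvdef, real_inner_smul_left, real_inner_self_eq_norm_sq, inv_mul_cancel₀ (by linarith)]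
  have hvn : ‖v‖ ≤ 2 := by
    rw [hvdef, norm_smul, norm_inv, norm_pow, norm_norm]
    have : (‖w‖ ^ 2)⁻¹ ≤ 2 := by
      rw [inv_le_comm₀ (by linarith) two_pos]
      linarith
    calc _ ≤ 2 * 1 := mul_le_mul this hw1 (norm_nonneg _) two_pos.le
      _ = 2 := by norm_num
  -- On the ball of radius `r / 8` the slab coordinate is at most `r / 4` in absolute value, so `2 *
  -- M + 1` translates of `S` in steps of `ε` cover that ball. The shifts have norm at most `2 * (r
  -- / 4 + ε)`, which keeps the shifted points in the ball of radius `r`.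
  set M : ℕ := ⌊r / (4 * ε)⌋₊ + 1 with hM
  have hMε : M * ε ≤ r / 4 + ε := by
    have h1 : ((⌊r / (4 * ε)⌋₊ : ℕ) : ℝ) ≤ r / (4 * ε) := Nat.floor_le (by positivity)
    have h2 : r / (4 * ε) * ε = r / 4 := by field_simp
    rw [hM]
    push_cast
    nlinarith
  have hMlt : r / 4 < M * ε := by
    have h1 : r / (4 * ε) < M := by
      rw [hM]
      push_cast
      exact Nat.lt_floor_add_one _
    rw [div_lt_iff₀ (by positivity)] at h1
    linarith
  have hcov : Metric.ball z (r / 8) ⊆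
      ⋃ k ∈ Finset.Icc (-(M : ℤ)) M, (fun x => x + (-((k : ℝ) * ε)) • v) ⁻¹' S := by
    intro x hx
    rw [Metric.mem_ball, dist_eq_norm] at hx
    have hxz : |inner ℝ x w - b| ≤ r / 4 := by
      have h1 : inner ℝ x w - b = inner ℝ (x - z) w + (inner ℝ z w - b) := by
        rw [inner_sub_left]
        ring
      have h2 : |inner ℝ (x - z) w| ≤ r / 8 := by
        refine (abs_real_inner_le_norm _ _).trans ?_
        nlinarith [norm_nonneg w, norm_nonneg (x - z)]
      rw [h1]
      exact (abs_add_le _ _).trans (by linarith)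
    set k : ℤ := ⌊(inner ℝ x w - b) / ε⌋ with hk
    have hk1 : (k : ℝ) * ε ≤ inner ℝ x w - b := by
      rw [← le_div_iff₀ hε]
      exact Int.floor_le _
    have hk2 : inner ℝ x w - b < (k + 1) * ε := by
      rw [← div_lt_iff₀ hε]
      exact Int.lt_floor_add_one _
    obtain ⟨h3, h4⟩ := abs_le.1 hxz
    have hkM : (k : ℝ) < M := by
      by_contra! h
      nlinarith
    have hkM' : -(M : ℝ) - 1 < k := by
      by_contra! h
      nlinarith
    have hkabs : |(k : ℝ) * ε| ≤ r / 4 + ε := by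
      rw [abs_le]
      constructor <;> nlinarith
    refine mem_iUnion₂.2 ⟨k, Finset.mem_Icc.2 ⟨?_, ?_⟩, ?_, ?_⟩
    · have : -(M : ℤ) - 1 < k := by exact_mod_cast hkM'
      omega
    · have : k < (M : ℤ) := by exact_mod_cast hkM
      omega
    · rw [Metric.mem_ball, dist_eq_norm, add_sub_right_comm]
      refine (norm_add_le _ _).trans_lt ?_
      rw [norm_smul, Real.norm_eq_abs, abs_neg]
      have : |(k : ℝ) * ε| * ‖v‖ ≤ (r / 4 + ε) * 2 :=
        mul_le_mul hkabs hvn (norm_nonneg _) (by positivity)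
      linarith
    · change |inner ℝ (x + (-((k : ℝ) * ε)) • v) w - b| ≤ ε
      rw [inner_add_left, real_inner_smul_left, hvw, abs_le]
      constructor <;> linarith
  have h1 : volume.real (Metric.ball z (r / 8)) ≤ (2 * M + 1) * volume.real S := by
    have hpre : ∀ a : Space n, volume ((fun x => x + a) ⁻¹' S) = volume S :=
      fun a => measure_preimage_add_right volume a S
    refine (measureReal_mono hcov ?_).trans ((measureReal_biUnion_finset_le _ _).trans ?_)
    · refine ((measure_biUnion_finset_le _ _).trans_lt (ENNReal.sum_lt_top.2 fun k _ => ?_)).ne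
      rw [hpre]
      exact hSfin.lt_top
    · simp only [measureReal_def, hpre, Finset.sum_const, Int.card_Icc, nsmul_eq_mul]
      refine mul_le_mul_of_nonneg_right ?_ ENNReal.toReal_nonneg
      rw [show ((M : ℤ) + 1 - -(M : ℤ)).toNat = 2 * M + 1 by omega]
      push_cast
      exact le_rfl
  have h2 : (2 * M + 1) * ε ≤ r := by nlinarith
  rw [div_mul_eq_mul_div, div_le_iff₀ hr]
  calc _ ≤ (2 * M + 1) * volume.real S * ε := mul_le_mul_of_nonneg_right h1 hε.le
    _ = volume.real S * ((2 * M + 1) * ε) := by ring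
    _ ≤ volume.real S * r := mul_le_mul_of_nonneg_left h2 measureReal_nonneg

/-! ### The reflection and its effect on the height -/

theorem reflect_apply_last (x : Space n) : reflect x (Fin.last n) = -x (Fin.last n) := by
  simp [reflect]

theorem reflect_reflect (x : Space n) : reflect (reflect x) = x := by
  ext i
  simp only [reflect]
  split_ifs <;> simp

/-- The reflection as a linear isometry. -/
def reflectEquiv (n : ℕ) : Space n ≃ₗᵢ[ℝ] Space n where
  toFun := reflect
  invFun := reflect
  left_inv := reflect_reflect
  right_inv := reflect_reflect
  map_add' x y := by
    ext i
    simp only [reflect, PiLp.add_apply]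
    split_ifs
    · ring
    · rfl
  map_smul' c x := by
    ext i
    simp [reflect]
  norm_map' x := by
    change ‖reflect x‖ = ‖x‖
    rw [EuclideanSpace.norm_eq, EuclideanSpace.norm_eq]
    congr 1
    refine Finset.sum_congr rfl fun i _ => ?_
    simp only [reflect]
    split_ifs <;> simp

theorem continuous_reflect : Continuous (reflect : Space n → Space n) :=
  (reflectEquiv n).continuous

theorem reflect_eq_sub_smul (x : Space n) :
    reflect x = x - (2 * x (Fin.last n)) • EuclideanSpace.single (Fin.last n) (1 : ℝ) := by
  ext i
  by_cases h : i = Fin.last n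
  · subst h
    simp [reflect]
    ring
  · simp [reflect, h]

theorem height_sub_height_reflect (s : ℝ) (x : Space n) :
    height ℓ Γ s x - height ℓ Γ s (reflect x) =
      2 * x (Fin.last n) * derivWithin Γ (Icc 0 ℓ) s (Fin.last n) := by
  rw [height, height, ← inner_sub_left, reflect_eq_sub_smul]
  rw [show x - Γ s - (x - (2 * x (Fin.last n)) • EuclideanSpace.single (Fin.last n) (1 : ℝ) - Γ s) =
    (2 * x (Fin.last n)) • EuclideanSpace.single (Fin.last n) (1 : ℝ) by abel,
    real_inner_smul_left, EuclideanSpace.inner_single_left]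
  simp

/-! ### The law of the random vector -/

variable {Ω : Type*} [MeasurableSpace Ω] {P : Measure Ω} {X : Ω → Space n} {p : Space n → ℝ}

theorem IsSmoothDensity.measurePreserving_reflect (hp : IsSmoothDensity P X K p)
    (hsym : IsReflectionallySymmetric p) : MeasurePreserving reflect (P.map X) (P.map X) := by
  refine ⟨continuous_reflect.measurable, ?_⟩
  ext S hS
  have hm : MeasurePreserving (reflect : Space n → Space n) volume volume :=
    (reflectEquiv n).measurePreserving
  rw [Measure.map_apply continuous_reflect.measurable hS, hp.law,
    withDensity_apply _ (continuous_reflect.measurable hS), withDensity_apply _ hS,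
    ← hm.setLIntegral_comp_preimage hS hp.measurable.ennreal_ofReal]
  simp_rw [hsym _]

theorem IsSmoothDensity.ae_mem (hp : IsSmoothDensity P X K p) : ∀ᵐ x ∂(P.map X), x ∈ K := by
  have hK : IsClosed K := hp.support ▸ isClosed_tsupport p
  change P.map X Kᶜ = 0
  rw [hp.law, withDensity_apply _ hK.measurableSet.compl]
  refine setLIntegral_eq_zero hK.measurableSet.compl fun x hx => ?_
  rw [image_eq_zero_of_notMem_tsupport (f := p) (x := x) (by rwa [hp.support]), ENNReal.ofReal_zero, Pi.zero_apply]

theorem IsSmoothDensity.mul_volume_le (hp : IsSmoothDensity P X K p) [IsFiniteMeasure P]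
    {B : Set (Space n)} (hB : MeasurableSet B) {c : ℝ} (hc : 0 ≤ c) (h : ∀ x ∈ B, c ≤ p x) :
    c * volume.real B ≤ (P.map X).real B := by
  have h1 : ENNReal.ofReal c * volume B ≤ P.map X B := by
    rw [hp.law, withDensity_apply _ hB, ← setLIntegral_const]
    exact setLIntegral_mono hp.measurable.ennreal_ofReal fun x hx => ENNReal.ofReal_le_ofReal (h x hx)
  have h2 := ENNReal.toReal_mono (measure_ne_top _ _) h1
  rwa [ENNReal.toReal_mul, ENNReal.toReal_ofReal hc] at h2

theorem IsSmoothDensity.measure_pos (hp : IsSmoothDensity P X K p)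
    (hK : closure (interior K) = K) {U : Set (Space n)} (hU : IsOpen U)
    (hUK : (U ∩ K).Nonempty) : 0 < P.map X U := by
  obtain ⟨x, hxU, hxK⟩ := hUK
  have hne : (U ∩ interior K).Nonempty := mem_closure_iff.1 (hK.symm ▸ hxK) U hU hxU
  have hO : IsOpen (U ∩ interior K) := hU.inter isOpen_interior
  refine lt_of_lt_of_le ?_ (measure_mono (inter_subset_left (t := interior K)))
  rw [hp.law, withDensity_apply _ hO.measurableSet,
    setLIntegral_pos_iff hp.measurable.ennreal_ofReal, inter_eq_self_of_subset_right]
  · exact hO.measure_pos _ hne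
  · intro y hy
    exact (ENNReal.ofReal_pos.2 (hp.pos y hy.2)).ne'

theorem IsSmoothDensity.integrable_of_continuous (hp : IsSmoothDensity P X K p)
    [IsFiniteMeasure P] (hK : IsCompact K) {E : Type*} [NormedAddCommGroup E] {g : Space n → E}
    (hg : Continuous g) : Integrable g (P.map X) := by
  obtain ⟨C, hC⟩ := hK.exists_bound_of_continuousOn hg.continuousOn
  exact Integrable.of_bound (hg.aestronglyMeasurable) C (hp.ae_mem.mono hC)

theorem continuous_height (s : ℝ) : Continuous (height ℓ Γ s) := by
  unfold height
  fun_prop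

/-! ### Self-consistency against mirror symmetry -/

/-- The self-consistency equation integrated over the part of the distribution that projects
to `Γ '' [0, s]`. -/
theorem setIntegral_last_eq [IsProbabilityMeasure P] (hX : Measurable X) (hK : IsCompact K)
    (hp : IsSmoothDensity P X K p) (hΓ : IsPrincipalCurve P X ℓ Γ) (hadm : IsAdmissible K ℓ Γ)
    {s : ℝ} (hs : s ∈ Icc 0 ℓ) :
    Integrable (fun x => Γ (projIndex ℓ Γ x) (Fin.last n)) (P.map X) ∧
    ∫ x in {x | height ℓ Γ s x ≤ 0}, x (Fin.last n) ∂(P.map X) =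
      ∫ x in {x | height ℓ Γ s x ≤ 0}, Γ (projIndex ℓ Γ x) (Fin.last n) ∂(P.map X) := by
  have hℓ := hΓ.jordan.length_pos
  have hc := hΓ.jordan.continuousOn
  have hlam := measurable_projIndex hℓ hc
  have hGm : Measurable fun x => Γ (projIndex ℓ Γ x) := by
    -- `Γ` is arbitrary outside `[0, ℓ]`; its constant extension is continuous and agrees with it at
    -- every projection index.
    have h1 : Continuous (IccExtend hℓ.le ((Icc 0 ℓ).domRestrict Γ)) :=
      (continuousOn_iff_continuous_domRestrict.1 hc).Icc_extend'
    convert h1.measurable.comp hlam using 2 with x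
    simp only [Function.comp]
    rw [IccExtend_of_mem _ _ (isClosestAt_projIndex hℓ hc x).1]
    rfl
  have hm : MeasurableSpace.comap (fun a => projIndex ℓ Γ (X a)) inferInstance ≤
      (inferInstance : MeasurableSpace Ω) := (hlam.comp hX).comap_le
  have hXint : Integrable X P :=
    (integrable_map_measure (g := id) (by fun_prop) hX.aemeasurable).1
      (hp.integrable_of_continuous hK continuous_id)
  have hGint : Integrable (fun a => Γ (projIndex ℓ Γ (X a))) P :=
    integrable_condExp.congr hΓ.selfConsistent
  have hGint' : Integrable (fun x => Γ (projIndex ℓ Γ x)) (P.map X) :=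
    (integrable_map_measure hGm.aestronglyMeasurable hX.aemeasurable).2 hGint
  let L : Space n →L[ℝ] ℝ := EuclideanSpace.proj (Fin.last n)
  have hA : MeasurableSet {x : Space n | projIndex ℓ Γ x ≤ s} := hlam measurableSet_Iic
  refine ⟨L.integrable_comp hGint', ?_⟩
  have hae : {x | height ℓ Γ s x ≤ 0} =ᵐ[P.map X] {x | projIndex ℓ Γ x ≤ s} := by
    filter_upwards [hp.ae_mem] with x hx
    exact propext (height_nonpos_iff hΓ.jordan hadm hx hs)
  rw [setIntegral_congr_set hae, setIntegral_congr_set hae]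
  have h1 : ∫ a in {a | projIndex ℓ Γ (X a) ≤ s}, X a ∂P =
      ∫ a in {a | projIndex ℓ Γ (X a) ≤ s}, Γ (projIndex ℓ Γ (X a)) ∂P := by
    refine (setIntegral_condExp hm hXint ⟨Iic s, measurableSet_Iic, rfl⟩).symm.trans ?_
    exact setIntegral_congr_ae (hm _ ⟨Iic s, measurableSet_Iic, rfl⟩)
      (hΓ.selfConsistent.mono fun a h _ => h)
  have h2 : ∫ x in {x | projIndex ℓ Γ x ≤ s}, x ∂(P.map X) =
      ∫ x in {x | projIndex ℓ Γ x ≤ s}, Γ (projIndex ℓ Γ x) ∂(P.map X) := by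
    rw [setIntegral_map hA (by fun_prop) hX.aemeasurable,
      setIntegral_map hA hGm.aestronglyMeasurable hX.aemeasurable]
    exact h1
  have h3 := congrArg L h2
  rw [← L.integral_comp_comm
      (hp.integrable_of_continuous (g := fun x : Space n => x) hK continuous_id).integrableOn,
    ← L.integral_comp_comm hGint'.integrableOn] at h3
  exact h3

/-- A half-space that is tilted by `τ` against the mirror has a first moment of the opposite
sign, and its size is controlled by the asymmetric part of the half-space. -/
theorem two_mul_setIntegral_last_le {μ : Measure (Space n)} [IsFiniteMeasure μ]
    (hμ : MeasurePreserving reflect μ μ)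
    (hint : Integrable (fun x : Space n => x (Fin.last n)) μ) {A B : Set (Space n)}
    (hA : MeasurableSet A) (hB : MeasurableSet B) {τ η : ℝ}
    (h1 : ∀ x ∈ A, reflect x ∉ A → τ * x (Fin.last n) ≤ 0)
    (hBA : ∀ x ∈ B, ¬(x ∈ A ↔ reflect x ∈ A)) (hη : ∀ x ∈ B, η ≤ |x (Fin.last n)|) :
    2 * (τ * ∫ x in A, x (Fin.last n) ∂μ) ≤ -(|τ| * η * μ.real B) := by
  set g : Space n → ℝ := A.indicator (fun x => x (Fin.last n)) with hg
  have hgi : Integrable g μ := hint.indicator hA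
  have e1 : ∫ x in A, x (Fin.last n) ∂μ = ∫ x, g x ∂μ := (integral_indicator hA).symm
  have e2 : ∫ x, g (reflect x) ∂μ = ∫ x, g x ∂μ :=
    hμ.integral_comp (reflectEquiv n).toHomeomorph.measurableEmbedding g
  have hgi2 : Integrable (fun x => g (reflect x)) μ := hμ.integrable_comp_of_integrable hgi
  -- Symmetrisation: `g x + g (reflect x)` vanishes when `A` contains both or neither of `x` and
  -- `reflect x`. Otherwise it is `± x_d`, with the sign that makes its product with `τ`
  -- nonpositive.
  have e3 : 2 * (τ * ∫ x in A, x (Fin.last n) ∂μ) = ∫ x, τ * (g x + g (reflect x)) ∂μ := by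
    rw [integral_const_mul, integral_add hgi hgi2, e1, e2]
    ring
  have e4 : -(|τ| * η * μ.real B) = ∫ x, B.indicator (fun _ => -(|τ| * η)) x ∂μ := by
    rw [integral_indicator_const _ hB, smul_eq_mul]
    ring
  rw [e3, e4]
  refine integral_mono ((hgi.add hgi2).const_mul τ)
    ((integrable_const _).indicator hB) fun x => ?_
  have key : x ∉ A → reflect x ∈ A → 0 ≤ τ * x (Fin.last n) := fun hx hrx => by
    have := h1 _ hrx (by rwa [reflect_reflect])
    rw [reflect_apply_last] at this
    linarith
  by_cases hxB : x ∈ B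
  · have h2 := hBA x hxB
    have h3 : |τ| * η ≤ |τ * x (Fin.last n)| := by
      rw [abs_mul]
      exact mul_le_mul_of_nonneg_left (hη x hxB) (abs_nonneg _)
    by_cases hx : x ∈ A <;> by_cases hrx : reflect x ∈ A <;>
      simp only [hx, hrx, iff_self, not_true_eq_false] at h2
    · simp only [hg, hx, hrx, hxB, indicator_of_mem, indicator_of_notMem, not_false_eq_true,
        add_zero]
      rw [abs_of_nonpos (h1 x hx hrx)] at h3
      linarith
    · simp only [hg, hx, hrx, hxB, indicator_of_mem, indicator_of_notMem, not_false_eq_true,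
        zero_add, reflect_apply_last]
      rw [abs_of_nonneg (key hx hrx)] at h3
      linarith
  · by_cases hx : x ∈ A <;> by_cases hrx : reflect x ∈ A <;>
      simp only [hg, hx, hrx, hxB, indicator_of_mem, indicator_of_notMem, not_false_eq_true,
        add_zero, zero_add, reflect_apply_last, add_neg_cancel, mul_zero, le_refl]
    · exact h1 x hx hrx
    · linarith [key hx hrx]

theorem IsSmoothJordanCurve.hasDerivWithinAt_last (h : IsSmoothJordanCurve ℓ Γ) {s : ℝ}
    (hs : s ∈ Icc 0 ℓ) :
    HasDerivWithinAt (fun t => Γ t (Fin.last n)) (derivWithin Γ (Icc 0 ℓ) s (Fin.last n))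
      (Icc 0 ℓ) s :=
  (EuclideanSpace.proj (𝕜 := ℝ) (Fin.last n) : Space n →L[ℝ] ℝ).hasFDerivAt.comp_hasDerivWithinAt
    s (h.hasDerivWithinAt hs)

theorem IsSmoothJordanCurve.continuousOn_last (h : IsSmoothJordanCurve ℓ Γ) :
    ContinuousOn (fun t => Γ t (Fin.last n)) (Icc 0 ℓ) :=
  fun _ hs => (h.hasDerivWithinAt_last hs).continuousWithinAt

theorem IsSmoothJordanCurve.continuousOn_derivWithin_last (h : IsSmoothJordanCurve ℓ Γ) :
    ContinuousOn (fun s => derivWithin Γ (Icc 0 ℓ) s (Fin.last n)) (Icc 0 ℓ) :=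
  (EuclideanSpace.proj (𝕜 := ℝ) (Fin.last n) : Space n →L[ℝ] ℝ).continuous.comp_continuousOn
    h.continuousOn_derivWithin

/-- The tilt of the curve against the mirror at time `s` and the accumulated signed distance of
the curve from the mirror up to time `s` have opposite signs. -/
theorem two_mul_tilt_mul_setIntegral_le [IsProbabilityMeasure P] (hX : Measurable X)
    (hK : IsCompact K) (hp : IsSmoothDensity P X K p) (hsym : IsReflectionallySymmetric p)
    (hΓ : IsPrincipalCurve P X ℓ Γ) (hadm : IsAdmissible K ℓ Γ) {s : ℝ} (hs : s ∈ Icc 0 ℓ)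
    {B : Set (Space n)} {η : ℝ} (hB : MeasurableSet B)
    (hBA : ∀ x ∈ B, ¬(height ℓ Γ s x ≤ 0 ↔ height ℓ Γ s (reflect x) ≤ 0))
    (hη : ∀ x ∈ B, η ≤ |x (Fin.last n)|) :
    2 * (derivWithin Γ (Icc 0 ℓ) s (Fin.last n) *
      ∫ x in {x | height ℓ Γ s x ≤ 0}, Γ (projIndex ℓ Γ x) (Fin.last n) ∂(P.map X)) ≤
      -(|derivWithin Γ (Icc 0 ℓ) s (Fin.last n)| * η * (P.map X).real B) := by
  rw [← (setIntegral_last_eq hX hK hp hΓ hadm hs).2]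
  refine two_mul_setIntegral_last_le (hp.measurePreserving_reflect hsym)
    (hp.integrable_of_continuous hK (by fun_prop))
    (isClosed_le (continuous_height s) continuous_const).measurableSet hB ?_ hBA hη
  intro x hx hrx
  have h1 := height_sub_height_reflect (ℓ := ℓ) (Γ := Γ) s x
  have h2 : height ℓ Γ s x ≤ 0 := hx
  have h3 : 0 < height ℓ Γ s (reflect x) := not_le.1 hrx
  linarith

/-! ### The initial segment -/

/-- Every time interval carries mass of the projection index. -/
theorem measure_pos_height_between [IsProbabilityMeasure P] (hK : IsCompactRegion K)
    (hp : IsSmoothDensity P X K p) (hΓ : IsSmoothJordanCurve ℓ Γ) (hΓK : MapsTo Γ (Icc 0 ℓ) K)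
    (hadm : IsAdmissible K ℓ Γ) {a t b : ℝ} (ha : 0 ≤ a) (hat : a < t) (htb : t < b)
    (hb : b ≤ ℓ) : 0 < P.map X {x | 0 < height ℓ Γ a x ∧ height ℓ Γ b x < 0} := by
  have ht : t ∈ Icc 0 ℓ := ⟨ha.trans hat.le, htb.le.trans hb⟩
  have hlam := projIndex_apply_curve hΓ ht
  refine hp.measure_pos hK.closure_interior
    ((isOpen_lt continuous_const (continuous_height a)).inter
      (isOpen_lt (continuous_height b) continuous_const)) ⟨Γ t, ⟨?_, ?_⟩, hΓK ht⟩
  · exact height_pos hΓ hadm (hΓK ht) ⟨ha, hat.le.trans ht.2⟩ (hlam.symm ▸ hat)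
  · exact height_neg hΓ hadm (hΓK ht) ⟨ht.1.trans htb.le, hb⟩ (hlam.symm ▸ htb)

/-- The sign `σ` treats both sides at once. If the curve left the mirror, it would still be moving
away at some `s` after having been strictly off it. Then the tilt inequality and one-sidedness force
`Γ_d(λ) = 0` almost surely on `{λ ≤ s}`, although times near an earlier off-mirror one carry mass.
-/
theorem last_eq_zero_of_starts_on_side [IsProbabilityMeasure P] (hX : Measurable X)
    (hK : IsCompactRegion K) (hp : IsSmoothDensity P X K p) (hsym : IsReflectionallySymmetric p)
    (hΓ : IsPrincipalCurve P X ℓ Γ) (hΓK : MapsTo Γ (Icc 0 ℓ) K) (hadm : IsAdmissible K ℓ Γ)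
    (h0 : Γ 0 (Fin.last n) = 0) {σ δ : ℝ} (hσ : σ ≠ 0)
    (hside : ∀ s ∈ Icc 0 ℓ, s ≤ δ → 0 ≤ σ * Γ s (Fin.last n)) {t : ℝ} (ht : t ∈ Icc 0 ℓ)
    (htδ : t ≤ δ) : Γ t (Fin.last n) = 0 := by
  by_contra hne
  have hpos : 0 < σ * Γ t (Fin.last n) := (hside t ht htδ).lt_of_ne' (mul_ne_zero hσ hne)
  have hcont : ContinuousOn (fun s => σ * Γ s (Fin.last n)) (Icc 0 ℓ) :=
    continuousOn_const.mul hΓ.jordan.continuousOn_last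
  -- Stopping at half the final value leaves a point already off the mirror and a positive mean
  -- slope from `t₁` to `t`.
  obtain ⟨t₁, ht₁, hγ₁⟩ := intermediate_value_Icc ht.1 (hcont.mono (Icc_subset_Icc_right ht.2))
    (show σ * Γ t (Fin.last n) / 2 ∈ Icc (σ * Γ 0 (Fin.last n)) (σ * Γ t (Fin.last n)) by
      rw [h0, mul_zero]
      constructor <;> linarith)
  simp only at hγ₁
  have ht₁0 : 0 < t₁ := ht₁.1.lt_of_ne (by
    rintro rfl
    rw [h0, mul_zero] at hγ₁
    linarith)
  have ht₁t : t₁ < t := ht₁.2.lt_of_ne (by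
    rintro rfl
    linarith)
  obtain ⟨s, hs, hslope⟩ := exists_hasDerivAt_eq_slope (fun s => σ * Γ s (Fin.last n))
    (fun s => σ * derivWithin Γ (Icc 0 ℓ) s (Fin.last n)) ht₁t
    (hcont.mono (Icc_subset_Icc ht₁0.le ht.2)) (fun s hs => by
      have hs' : s ∈ Ioo 0 ℓ := ⟨ht₁0.trans hs.1, hs.2.trans_le ht.2⟩
      exact ((hΓ.jordan.hasDerivWithinAt_last (Ioo_subset_Icc_self hs')).hasDerivAt
        (Icc_mem_nhds hs'.1 hs'.2)).const_mul σ)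
  have htilt : 0 < σ * derivWithin Γ (Icc 0 ℓ) s (Fin.last n) := by
    rw [hslope]
    exact div_pos (by linarith) (sub_pos.2 ht₁t)
  have hsI : s ∈ Icc 0 ℓ := ⟨ht₁0.le.trans hs.1.le, hs.2.le.trans ht.2⟩
  have hA : MeasurableSet {x | height ℓ Γ s x ≤ 0} :=
    (isClosed_le (continuous_height s) continuous_const).measurableSet
  have hint := (setIntegral_last_eq hX hK.isCompact hp hΓ hadm hsI).1
  -- Only the sign is needed here, so the gain set is empty.
  have hI := two_mul_tilt_mul_setIntegral_le hX hK.isCompact hp hsym hΓ hadm hsI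
    (B := ∅) (η := 0) .empty (by simp) (by simp)
  rw [measureReal_empty, mul_zero, neg_zero] at hI
  set I := ∫ x in {x | height ℓ Γ s x ≤ 0}, Γ (projIndex ℓ Γ x) (Fin.last n) ∂(P.map X) with hIdef
  have hσI : σ * I ≤ 0 := by
    by_contra! h
    nlinarith [mul_pos htilt h, sq_nonneg σ]
  have hnn : 0 ≤ᵐ[(P.map X).restrict {x | height ℓ Γ s x ≤ 0}]
      fun x => σ * Γ (projIndex ℓ Γ x) (Fin.last n) := by
    refine (ae_restrict_iff' hA).2 (hp.ae_mem.mono fun x hx hxA => ?_)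
    refine hside _ (isClosestAt_projIndex hΓ.jordan.length_pos hΓ.jordan.continuousOn x).1 ?_
    exact ((height_nonpos_iff hΓ.jordan hadm hx hsI).1 hxA).trans (hs.2.le.trans htδ)
  have hzero : σ * I = 0 := by
    refine hσI.antisymm ?_
    rw [hIdef, ← integral_const_mul]
    exact integral_nonneg_of_ae hnn
  rw [hIdef, ← integral_const_mul,
    integral_eq_zero_iff_of_nonneg_ae hnn (hint.const_mul σ).integrableOn] at hzero
  replace hzero := (ae_restrict_iff' hA).1 hzero
  have hev : ∀ᶠ u in nhds t₁, 0 < σ * Γ u (Fin.last n) := by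
    have hc := hcont.continuousAt (Icc_mem_nhds ht₁0 (ht₁t.trans_le ht.2))
    refine hc.eventually (lt_mem_nhds ?_)
    linarith
  obtain ⟨a, b, ⟨hat, htb⟩, hab⟩ := mem_nhds_iff_exists_Ioo_subset.1 hev
  have hpm := measure_pos_height_between hK hp hΓ.jordan hΓK hadm (le_max_right a 0)
    (max_lt hat ht₁0) (lt_min htb hs.1) ((min_le_right b s).trans hsI.2)
  refine hpm.ne' (measure_eq_zero_iff_ae_notMem.2 ?_)
  filter_upwards [hzero, hp.ae_mem] with x hx hxK hxU
  have haI : max a 0 ∈ Icc 0 ℓ := ⟨le_max_right _ _, (max_lt hat ht₁0).le.trans (ht₁.2.trans ht.2)⟩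
  have hbI : min b s ∈ Icc 0 ℓ :=
    ⟨(ht₁0.trans (lt_min htb hs.1)).le, (min_le_right b s).trans hsI.2⟩
  have h1 : max a 0 < projIndex ℓ Γ x := by
    by_contra! h
    exact hxU.1.not_ge ((height_nonpos_iff hΓ.jordan hadm hxK haI).2 h)
  have h2 : projIndex ℓ Γ x < min b s := by
    refine ((height_nonpos_iff hΓ.jordan hadm hxK hbI).1 hxU.2.le).lt_of_ne fun h => ?_
    exact hxU.2.ne ((height_eq_zero_iff hΓ.jordan hadm hxK hbI).2 h.symm)
  have h3 := hx ((height_nonpos_iff hΓ.jordan hadm hxK hsI).2 (h2.le.trans (min_le_right _ _)))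
  have h4 : 0 < σ * Γ (projIndex ℓ Γ x) (Fin.last n) :=
    hab ⟨(le_max_left _ _).trans_lt h1, h2.trans_le (min_le_left _ _)⟩
  exact h4.ne' h3

/-! ### Continuation past an intermediate time -/

/-- The normal hyperplane at an intermediate time at which the curve is parallel to the mirror
meets the interior of `K` off the mirror. -/
theorem exists_mem_interior_height_eq_zero (hK : IsCompactRegion K) (hΓ : IsSmoothJordanCurve ℓ Γ)
    (hΓK : MapsTo Γ (Icc 0 ℓ) K) (hadm : IsAdmissible K ℓ Γ) {s : ℝ} (hs : s ∈ Ioo 0 ℓ)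
    (hT : derivWithin Γ (Icc 0 ℓ) s (Fin.last n) = 0) :
    ∃ z ∈ interior K, height ℓ Γ s z = 0 ∧ z (Fin.last n) ≠ 0 := by
  have hsI := Ioo_subset_Icc_self hs
  have hℓ := hΓ.length_pos
  have h0 : (0 : ℝ) ∈ Icc 0 ℓ := left_mem_Icc.2 hℓ.le
  have h1 : ℓ ∈ Icc 0 ℓ := right_mem_Icc.2 hℓ.le
  -- The endpoints of the curve lie strictly on opposite sides of the hyperplane, so interior points
  -- near them do too; connectedness of the interior yields a crossing point.
  obtain ⟨x, hx, hxK⟩ := mem_closure_iff.1 (hK.closure_interior.symm ▸ hΓK h0)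
    {x | height ℓ Γ s x < 0} (isOpen_lt (continuous_height s) continuous_const)
    (height_neg hΓ hadm (hΓK h0) hsI ((projIndex_apply_curve hΓ h0).symm ▸ hs.1))
  obtain ⟨y, hy, hyK⟩ := mem_closure_iff.1 (hK.closure_interior.symm ▸ hΓK h1)
    {x | 0 < height ℓ Γ s x} (isOpen_lt continuous_const (continuous_height s))
    (height_pos hΓ hadm (hΓK h1) hsI ((projIndex_apply_curve hΓ h1).symm ▸ hs.2))
  obtain ⟨z, hzK, hz⟩ := hK.isConnected_interior.isPreconnected.intermediate_value hxK hyK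
    (continuous_height s).continuousOn ⟨hx.le, hy.le⟩
  -- As the tangent is parallel to the mirror, a crossing point on the mirror can be pushed off it
  -- within the hyperplane.
  by_cases hzl : z (Fin.last n) = 0
  swap
  · exact ⟨z, hzK, hz, hzl⟩
  obtain ⟨r, hr, hball⟩ := Metric.isOpen_iff.1 isOpen_interior z hzK
  refine ⟨z + EuclideanSpace.single (Fin.last n) (r / 2), hball ?_, ?_, ?_⟩
  · rw [Metric.mem_ball, dist_eq_norm, add_sub_cancel_left, PiLp.norm_single,
      Real.norm_of_nonneg (by positivity)]
    linarith
  · rw [height, add_sub_right_comm, inner_add_left, EuclideanSpace.inner_single_left, hT, mul_zero,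
      add_zero]
    exact hz
  · simp [hzl, hr.ne']

/-- Splitting the tangent into its mirror-parallel part and its tilt separates the
reflection-invariant part of the height from the part that changes sign. -/
theorem height_eq_inner_add (s : ℝ) (x : Space n) :
    height ℓ Γ s x = inner ℝ x (derivWithin Γ (Icc 0 ℓ) s -
        EuclideanSpace.single (Fin.last n) (derivWithin Γ (Icc 0 ℓ) s (Fin.last n))) -
      inner ℝ (Γ s) (derivWithin Γ (Icc 0 ℓ) s) +
      derivWithin Γ (Icc 0 ℓ) s (Fin.last n) * x (Fin.last n) := by
  rw [height, inner_sub_left, inner_sub_right, EuclideanSpace.inner_single_right]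
  simp
  ring

theorem norm_sub_single_last_sq (v : Space n) :
    ‖v - EuclideanSpace.single (Fin.last n) (v (Fin.last n))‖ ^ 2 =
      ‖v‖ ^ 2 - v (Fin.last n) ^ 2 := by
  rw [norm_sub_sq_real, EuclideanSpace.inner_single_right, PiLp.norm_single,
    Real.norm_eq_abs, sq_abs]
  simp
  ring

/-- Near an interior point `z` of the hyperplane off the mirror, a slab of width proportional to
`|τ|` consists of points separated from their mirror images by the tilted hyperplane. Its mass is at
least of order `|τ|`, so the gain is of order `τ ^ 2`; dividing by `|τ|` leaves a linear bound. -/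
theorem eventually_mul_abs_tilt_le [IsProbabilityMeasure P] (hX : Measurable X)
    (hK : IsCompactRegion K) (hp : IsSmoothDensity P X K p) (hsym : IsReflectionallySymmetric p)
    (hΓ : IsPrincipalCurve P X ℓ Γ) (hΓK : MapsTo Γ (Icc 0 ℓ) K) (hadm : IsAdmissible K ℓ Γ)
    {s₀ : ℝ} (hs₀ : s₀ ∈ Ioo 0 ℓ) (hT : derivWithin Γ (Icc 0 ℓ) s₀ (Fin.last n) = 0) :
    ∃ c > 0, ∀ᶠ s in nhdsWithin s₀ (Icc 0 ℓ),
      c * |derivWithin Γ (Icc 0 ℓ) s (Fin.last n)| ≤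
        |∫ x in {x | height ℓ Γ s x ≤ 0}, Γ (projIndex ℓ Γ x) (Fin.last n) ∂(P.map X)| := by
  have hs₀I := Ioo_subset_Icc_self hs₀
  obtain ⟨z, hzK, hz, hzl⟩ := exists_mem_interior_height_eq_zero hK hΓ.jordan hΓK hadm hs₀ hT
  set η : ℝ := |z (Fin.last n)| / 2 with hη
  have hzabs : 0 < |z (Fin.last n)| := abs_pos.2 hzl
  have hηpos : 0 < η := by positivity
  have hpz := hp.pos z hzK
  have hev : ∀ᶠ x in nhds z, p z / 2 < p x ∧ η < |x (Fin.last n)| := by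
    refine ((hp.smooth.continuousOn.continuousAt (isOpen_interior.mem_nhds hzK)).eventually
      (lt_mem_nhds (by linarith))).and ?_
    have hc : Continuous fun x : Space n => |x (Fin.last n)| := by fun_prop
    exact hc.continuousAt.eventually (lt_mem_nhds (by linarith))
  obtain ⟨r, hr, hball⟩ := Metric.eventually_nhds_iff_ball.1 hev
  obtain ⟨c, hc, hslab⟩ := exists_mul_le_volume_slab z hr
  -- The factors are the lower bound `p z / 2` of the density, the slab constant `c`, one `η` from
  -- the slab width and one from `|x_d|`; the last `2` comes from the tilt inequality.
  refine ⟨p z / 2 * c * η ^ 2 / 2, by positivity, ?_⟩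
  have hTc := hΓ.jordan.continuousOn_derivWithin_last s₀ hs₀I
  have hhc := continuousOn_height hΓ.jordan z s₀ hs₀I
  -- These three smallness conditions are the hypotheses of the slab estimate for `w`, the
  -- mirror-parallel part of the tangent, with `‖w‖ ^ 2 = 1 - τ ^ 2`.
  have hev1 : ∀ᶠ s in nhdsWithin s₀ (Icc 0 ℓ),
      derivWithin Γ (Icc 0 ℓ) s (Fin.last n) ^ 2 < 1 / 2 :=
    (hTc.pow 2).eventually (gt_mem_nhds (by simp [hT]))
  have hev2 : ∀ᶠ s in nhdsWithin s₀ (Icc 0 ℓ),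
      η * |derivWithin Γ (Icc 0 ℓ) s (Fin.last n)| < r / 16 :=
    (continuousWithinAt_const.mul hTc.abs).eventually (gt_mem_nhds (by simp [hT, hr]))
  have hev3 : ∀ᶠ s in nhdsWithin s₀ (Icc 0 ℓ),
      |height ℓ Γ s z - derivWithin Γ (Icc 0 ℓ) s (Fin.last n) * z (Fin.last n)| < r / 8 :=
    (hhc.sub (hTc.mul continuousWithinAt_const)).abs.eventually
      (gt_mem_nhds (by simp [hT, hz, hr]))
  filter_upwards [hev1, hev2, hev3, self_mem_nhdsWithin] with s h1 h2 h3 hsI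
  set τ := derivWithin Γ (Icc 0 ℓ) s (Fin.last n) with hτ
  set I := ∫ x in {x | height ℓ Γ s x ≤ 0}, Γ (projIndex ℓ Γ x) (Fin.last n) ∂(P.map X) with hI
  rcases eq_or_ne τ 0 with hτ0 | hτ0
  · rw [hτ0, abs_zero, mul_zero]
    exact abs_nonneg _
  have hτpos : 0 < |τ| := abs_pos.2 hτ0
  set w : Space n := derivWithin Γ (Icc 0 ℓ) s - EuclideanSpace.single (Fin.last n) τ with hw
  set b : ℝ := inner ℝ (Γ s) (derivWithin Γ (Icc 0 ℓ) s) with hb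
  have hwn : ‖w‖ ^ 2 = 1 - τ ^ 2 := by
    rw [hw, hτ, norm_sub_single_last_sq, hΓ.jordan.unit_speed s hsI, one_pow]
  have hheight : ∀ x, height ℓ Γ s x = inner ℝ x w - b + τ * x (Fin.last n) :=
    height_eq_inner_add s
  have hvol := hslab w b (η * |τ|) (by rw [hwn]; linarith)
    (by
      rw [← sq_le_one_iff₀ (norm_nonneg _), hwn]
      linarith [sq_nonneg τ])
    (by
      rw [hheight, add_sub_cancel_right] at h3
      exact h3.le) (by positivity) h2.le
  set B : Set (Space n) := Metric.ball z r ∩ {x | |inner ℝ x w - b| ≤ η * |τ|} with hB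
  have hBm : MeasurableSet B := Metric.isOpen_ball.measurableSet.inter
    (isClosed_le (by fun_prop) continuous_const).measurableSet
  have hμB := hp.mul_volume_le hBm (c := p z / 2) (by positivity) fun x hx => (hball x hx.1).1.le
  have hmain := two_mul_tilt_mul_setIntegral_le hX hK.isCompact hp hsym hΓ hadm hsI hBm (η := η)
    (fun x hx => by
      have e1 := hheight x
      have e2 := hheight (reflect x)
      have e3 := height_sub_height_reflect (ℓ := ℓ) (Γ := Γ) s x
      rw [← hτ] at e3
      -- In the slab the tilt term dominates, so it fixes the sign of the height, and reflection
      -- reverses that sign.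
      have e4 : |inner ℝ x w - b| < |τ * x (Fin.last n)| := by
        rw [abs_mul, mul_comm |τ|]
        exact lt_of_le_of_lt hx.2 (mul_lt_mul_of_pos_right (hball x hx.1).2 hτpos)
      have e5 : height ℓ Γ s (reflect x) = inner ℝ x w - b - τ * x (Fin.last n) := by linarith
      rw [e1, e5]
      intro hiff
      rcases abs_cases (τ * x (Fin.last n)) with ⟨h, -⟩ | ⟨h, -⟩ <;> rw [h, abs_lt] at e4
      · linarith [hiff.2 (by linarith)]
      · linarith [hiff.1 (by linarith)])
    (fun x hx => (hball x hx.1).2.le)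
  rw [← hτ, ← hI] at hmain
  have h4 : p z / 2 * (c * (η * |τ|)) ≤ (P.map X).real B :=
    (mul_le_mul_of_nonneg_left hvol (by positivity)).trans hμB
  have h5 : |τ| * η * (p z / 2 * (c * (η * |τ|))) ≤ 2 * (|τ| * |I|) := by
    have h6 := mul_le_mul_of_nonneg_left h4 (show 0 ≤ |τ| * η by positivity)
    have h7 := neg_abs_le (τ * I)
    rw [abs_mul] at h7
    linarith
  refine le_of_mul_le_mul_left ?_ hτpos
  linarith

/-- At the time `s'` of maximal tilt `M` on `[s₀, s₁]`, the lower bound `c * M` for `|I(s')|` meets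
the upper bound `M * (s' - s₀)`. -/
theorem exists_gt_forall_last_eq_zero [IsProbabilityMeasure P] (hX : Measurable X)
    (hK : IsCompactRegion K) (hp : IsSmoothDensity P X K p) (hsym : IsReflectionallySymmetric p)
    (hΓ : IsPrincipalCurve P X ℓ Γ) (hΓK : MapsTo Γ (Icc 0 ℓ) K) (hadm : IsAdmissible K ℓ Γ)
    {s₀ : ℝ} (hs₀ : s₀ ∈ Ioo 0 ℓ) (hzero : ∀ t ∈ Icc 0 s₀, Γ t (Fin.last n) = 0) :
    ∃ s₁ ∈ Ioc s₀ ℓ, ∀ t ∈ Icc 0 s₁, Γ t (Fin.last n) = 0 := by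
  have hs₀I := Ioo_subset_Icc_self hs₀
  have hT : derivWithin Γ (Icc 0 ℓ) s₀ (Fin.last n) = 0 := by
    have hd := (hΓ.jordan.hasDerivWithinAt_last hs₀I).mono (Icc_subset_Icc_right hs₀.2.le)
    have hd0 : HasDerivWithinAt (fun t => Γ t (Fin.last n)) 0 (Icc 0 s₀) s₀ :=
      (hasDerivWithinAt_const s₀ (Icc 0 s₀) (0 : ℝ)).congr hzero
        (hzero s₀ (right_mem_Icc.2 hs₀.1.le))
    exact (uniqueDiffOn_Icc hs₀.1 s₀ (right_mem_Icc.2 hs₀.1.le)).eq_deriv _ hd hd0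
  obtain ⟨c, hc, hev⟩ := eventually_mul_abs_tilt_le hX hK hp hsym hΓ hΓK hadm hs₀ hT
  obtain ⟨ε, hε, hball⟩ := Metric.mem_nhdsWithin_iff.1 hev
  -- `ε / 2` keeps the interval where the lower bound holds; `c / 2` makes `M * (s' - s₀)` at most
  -- half of `c * M`, so that `M = 0`.
  set s₁ := min ℓ (s₀ + min (ε / 2) (c / 2)) with hs₁
  have hlt : s₀ < s₁ := lt_min hs₀.2 (by linarith [lt_min (half_pos hε) (half_pos hc)])
  have hle : s₁ ≤ s₀ + min (ε / 2) (c / 2) := min_le_right _ _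
  have hs₁ℓ : s₁ ≤ ℓ := min_le_left _ _
  have hle1 : s₁ ≤ s₀ + ε / 2 := hle.trans (by linarith [min_le_left (ε / 2) (c / 2)])
  have hle2 : s₁ ≤ s₀ + c / 2 := hle.trans (by linarith [min_le_right (ε / 2) (c / 2)])
  have hsub : Icc s₀ s₁ ⊆ Icc 0 ℓ := Icc_subset_Icc hs₀.1.le hs₁ℓ
  obtain ⟨s', hs', hmax⟩ := isCompact_Icc.exists_isMaxOn (nonempty_Icc.2 hlt.le)
    ((hΓ.jordan.continuousOn_derivWithin_last.mono hsub).abs)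
  set M := |derivWithin Γ (Icc 0 ℓ) s' (Fin.last n)| with hM
  have hbound : ∀ u ∈ Icc 0 s₁, |Γ u (Fin.last n)| ≤ M * max 0 (u - s₀) := by
    intro u hu
    rcases le_total u s₀ with h | h
    · rw [hzero u ⟨hu.1, h⟩, abs_zero]
      positivity
    have := (convex_Icc s₀ s₁).norm_image_sub_le_of_norm_hasDerivWithin_le
      (fun v hv => (hΓ.jordan.hasDerivWithinAt_last (hsub hv)).mono hsub)
      (fun v hv => hmax hv) (left_mem_Icc.2 hlt.le) ⟨h, hu.2⟩
    rw [hzero s₀ (right_mem_Icc.2 hs₀.1.le), sub_zero] at this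
    rw [max_eq_right (sub_nonneg.2 h)]
    rwa [Real.norm_eq_abs, Real.norm_eq_abs, abs_of_nonneg (sub_nonneg.2 h)] at this
  have hMnn : 0 ≤ M := abs_nonneg _
  have hI : |∫ x in {x | height ℓ Γ s' x ≤ 0}, Γ (projIndex ℓ Γ x) (Fin.last n) ∂(P.map X)| ≤
      M * (s' - s₀) := by
    have : IsProbabilityMeasure (P.map X) := Measure.isProbabilityMeasure_map hX.aemeasurable
    have hae : ∀ᵐ x ∂(P.map X), x ∈ {x | height ℓ Γ s' x ≤ 0} →
        ‖Γ (projIndex ℓ Γ x) (Fin.last n)‖ ≤ M * (s' - s₀) := by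
      filter_upwards [hp.ae_mem] with x hx hxA
      have h1 := (height_nonpos_iff hΓ.jordan hadm hx (hsub hs')).1 hxA
      have h2 := (isClosestAt_projIndex hΓ.jordan.length_pos hΓ.jordan.continuousOn x).1
      refine (hbound _ ⟨h2.1, h1.trans hs'.2⟩).trans (mul_le_mul_of_nonneg_left ?_ hMnn)
      exact max_le (sub_nonneg.2 hs'.1) (by linarith)
    exact (norm_setIntegral_le_of_norm_le_const_ae' (measure_lt_top _ _) hae).trans
      (mul_le_of_le_one_right (mul_nonneg hMnn (sub_nonneg.2 hs'.1)) measureReal_le_one)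
  have hcM : c * M ≤ _ := hball ⟨by
    rw [Metric.mem_ball, Real.dist_eq, abs_of_nonneg (sub_nonneg.2 hs'.1)]
    linarith [hs'.2], hsub hs'⟩
  have hM0 : M = 0 := by
    have := hcM.trans hI
    nlinarith [hs'.2]
  refine ⟨s₁, ⟨hlt, hs₁ℓ⟩, fun t ht => ?_⟩
  have := hbound t ht
  rw [hM0, zero_mul] at this
  exact abs_nonpos_iff.1 this

end PrincipalCurve

/-! ### Conclusion by a supremum argument -/

theorem mainTheorem3 {Ω : Type*} [MeasurableSpace Ω] (P : Measure Ω) [IsProbabilityMeasure P]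
    (n : ℕ) (hn : 1 ≤ n)
    (X : Ω → PrincipalCurve.Space n) (hX : Measurable X)
    (K : Set (PrincipalCurve.Space n)) (hK : PrincipalCurve.IsCompactRegion K)
    (p : PrincipalCurve.Space n → ℝ) (hp : PrincipalCurve.IsSmoothDensity P X K p)
    (hsym : PrincipalCurve.IsReflectionallySymmetric p)
    (ℓ : ℝ) (Γ : ℝ → PrincipalCurve.Space n)
    (hΓ : PrincipalCurve.IsPrincipalCurve P X ℓ Γ)
    (hΓK : MapsTo Γ (Icc 0 ℓ) K)
    (hadm : PrincipalCurve.IsAdmissible K ℓ Γ)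
    (hside : PrincipalCurve.StartsOnOneSide ℓ Γ)
    (hstart : Γ 0 ∈ frontier K ∩ PrincipalCurve.symHyperplane n) :
    ∀ s ∈ Icc 0 ℓ, Γ s ∈ PrincipalCurve.symHyperplane n := by
  have h0 : Γ 0 (Fin.last n) = 0 := hstart.2
  have hℓ := hΓ.jordan.length_pos
  obtain ⟨δ, hδ, hδ0⟩ : ∃ δ > 0, ∀ t ∈ Icc 0 ℓ, t ≤ δ → Γ t (Fin.last n) = 0 := by
    obtain ⟨δ, hδ, h | h⟩ := hside
    · exact ⟨δ, hδ, fun t ht htδ => PrincipalCurve.last_eq_zero_of_starts_on_side hX hK hp hsym hΓ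
        hΓK hadm h0 one_ne_zero (fun s hs hsδ => by rw [one_mul]; exact h s hs hsδ) ht htδ⟩
    · exact ⟨δ, hδ, fun t ht htδ => PrincipalCurve.last_eq_zero_of_starts_on_side hX hK hp hsym hΓ
        hΓK hadm h0 (neg_ne_zero.2 one_ne_zero)
        (fun s hs hsδ => by linarith [h s hs hsδ]) ht htδ⟩
  -- The times up to which the curve lies on the mirror: the supremum is positive by the initial
  -- segment, is attained by closedness, and cannot be less than `ℓ` by continuation.
  set S : Set ℝ := {s | s ∈ Icc 0 ℓ ∧ ∀ t ∈ Icc 0 s, Γ t (Fin.last n) = 0} with hS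
  have hSb : BddAbove S := ⟨ℓ, fun s hs => hs.1.2⟩
  have hmem : min δ ℓ ∈ S := ⟨⟨(lt_min hδ hℓ).le, min_le_right _ _⟩,
    fun t ht => hδ0 t ⟨ht.1, ht.2.trans (min_le_right _ _)⟩ (ht.2.trans (min_le_left _ _))⟩
  set s₀ := sSup S with hs₀
  have hs₀pos : 0 < s₀ := (lt_min hδ hℓ).trans_le (le_csSup hSb hmem)
  have hs₀ℓ : s₀ ≤ ℓ := csSup_le ⟨_, hmem⟩ fun s hs => hs.1.2
  have hzero : ∀ t ∈ Icc 0 s₀, Γ t (Fin.last n) = 0 := by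
    have hcl : IsClosed (Icc 0 ℓ ∩ (fun t => Γ t (Fin.last n)) ⁻¹' {0}) :=
      hΓ.jordan.continuousOn_last.preimage_isClosed_of_isClosed isClosed_Icc isClosed_singleton
    have hsub : Ico 0 s₀ ⊆ Icc 0 ℓ ∩ (fun t => Γ t (Fin.last n)) ⁻¹' {0} := by
      intro t ht
      obtain ⟨s, hs, hts⟩ := exists_lt_of_lt_csSup ⟨_, hmem⟩ ht.2
      exact ⟨⟨ht.1, ht.2.le.trans hs₀ℓ⟩, hs.2 t ⟨ht.1, hts.le⟩⟩
    intro t ht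
    rw [← closure_Ico hs₀pos.ne] at ht
    exact (closure_minimal hsub hcl ht).2
  rcases hs₀ℓ.eq_or_lt with h | h
  · exact fun s hs => hzero s (h ▸ hs)
  · obtain ⟨s₁, hs₁, hz⟩ := PrincipalCurve.exists_gt_forall_last_eq_zero hX hK hp hsym hΓ hΓK hadm
      ⟨hs₀pos, h⟩ hzero
    exact absurd (le_csSup hSb ⟨⟨hs₀pos.le.trans hs₁.1.le, hs₁.2⟩, hz⟩) hs₁.1.not_ge
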